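/- **Theorem 5.2 (twisted radical theorem).** Let $(V,Y,\mathbf 1,\omega)$ be a vertex operator algebra over $\mathbb C$, with $L(n)=\omega_{n+1}$ for $n\in\mathbb Z$, where $Y(u,z)=\sum_{n\in\mathbb Z}u_nz^{-n-1}$. Assume that $V$ is of CFT type, that is, $V$ is simple, $V=\bigoplus_{n\ge 0}V_n$ and $\dim V_0=1$. Let $g$ be an automorphism of $V$ of finite order $T$, and put $V^r=\{v\in V: gv=e^{-2\pi i r/T}v\}$ for $0\le r<T$; in particular $V^0=\{v\in V: gv=v\}$ is a vertex operator subalgebra of $V$ with the same vacuum and Virasoro vector, and we write $V^0_n=V^0\cap V_n$. Let $M$ be an admissible $g$-twisted $V$-module, that is, a complex vector space with a linear map $v\mapsto Y_M(v,z)=\sum_{n\in\mathbb Q}v_nz^{-n-1}$, $v_n\in\mathrm{End}\,M$, such that * $Y_M(u,z)=\sum_{n\in r/T+\mathbb Z}u_nz^{-n-1}$ for $u\in V^r$; for all $u\in V$ and $w\in M$ one has $u_nw=0$ for all sufficiently large $n$; and $Y_M(\mathbf 1,z)=\mathrm{id}_M$; * for $0\le r<T$, $u\in V^r$ and $v\in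 V$, $$z_0^{-1}\delta\Big(\frac{z_1-z_2}{z_0}\Big)Y_M(u,z_1)Y_M(v,z_2)-z_0^{-1}\delta\Big(\frac{z_2-z_1}{-z_0}\Big)Y_M(v,z_2)Y_M(u,z_1)=z_2^{-1}\Big(\frac{z_1-z_0}{z_2}\Big)^{-r/T}\delta\Big(\frac{z_1-z_0}{z_2}\Big)Y_M(Y(u,z_0)v,z_2),$$ where $\delta(z)=\sum_{n\in\mathbb Z}z^n$ and powers of binomials are expanded in nonnegative powers of the second variable; * $M=\bigoplus_{n=0}^{\infty}M(n/T)$ with $M(0)\neq 0$ and $v_mM(n/T)\subseteq M(n/T+k-m-1)$ for $v\in V_k$ and $m\in\mathbb Q$, where $M(q)=0$ if $q\notin\{0,\tfrac1T,\tfrac2T,\dots\}$. Then $M$ is in particular a weak $V^0$-module. For a weak $V^0$-module $N$ let $o\colon V^0\to\mathrm{End}\,N$ be the linear map with $o(v)=v_{k-1}$ for $v\in V^0_k$, and set $$J_N(V^0)=\{v\in V^0: o(v)=0\text{ on }N\},\qquad J_N(V^0)_{(0,1)}=(V^0_0\oplus V^0_1)\cap J_N(V^0).$$ Then $$J_M(V^0)=(L(0)+L(-1))V^0+J_M(V^0)_{(0,1)}.$$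 Moreover, if $a=a^0+a^1\in J_M(V^0)_{(0,1)}$ with $a^i\in V^0_i$, then $a^1\in J_{V^0}(V^0)$, where $V^0$ is regarded as a module over itself. -/

import Mathlib

/-!
# Vertex operator algebras, twisted modules and radicals

A formal series `Y(u, z) = ∑ u_n z ^ (-n-1)` is given by its family of modes `u_n`, that is, by the
linear map sending `u` to the function `n ↦ u_n`. The Jacobi identity is stated as the equality, for
all `k, m, n`, of the coefficients of `z₀ ^ (-k-1) z₁ ^ (-m-1) z₂ ^ (-n-1)` of its two sides; all
the sums that occur in it are finite because of the truncation axiom.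
-/

/-- A vertex operator algebra structure `(V, Y, 𝟏, ω)` on a complex vector space `V`. -/
structure VertexOperatorAlgebra (V : Type*) [AddCommGroup V] [Module ℂ V] where
  /-- `mode u n` is the coefficient `u_n` of `z ^ (-n-1)` in `Y(u, z)`. -/
  mode : V →ₗ[ℂ] (ℤ → Module.End ℂ V)
  /-- The vacuum vector. -/
  vac : V
  /-- The conformal (Virasoro) vector. -/
  conf : V
  /-- The central charge. -/
  charge : ℂ
  /-- `wt n` is the weight space `V_n`. -/
  wt : ℤ → Submodule ℂ V
  isInternal : DirectSum.IsInternal wt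
  finiteDimensional (n : ℤ) : FiniteDimensional ℂ (wt n)
  lower_bound : ∃ N : ℤ, ∀ n < N, wt n = ⊥
  vac_mem : vac ∈ wt 0
  conf_mem : conf ∈ wt 2
  truncation (u v : V) : ∃ N : ℤ, ∀ n ≥ N, mode u n v = 0
  mode_vac (n : ℤ) (v : V) : mode vac n v = if n = -1 then v else 0
  creation (v : V) : (∀ n : ℤ, 0 ≤ n → mode v n vac = 0) ∧ mode v (-1) vac = v
  jacobi (u v w : V) (k m n : ℤ) :
    ∑ᶠ i : ℕ, Ring.choose (m : ℂ) i • mode (mode u (k + i) v) (m + n - i) w =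
      ∑ᶠ i : ℕ, ((-1 : ℂ) ^ i * Ring.choose (k : ℂ) i) • mode u (m + k - i) (mode v (n + i) w) -
      ∑ᶠ i : ℕ, ((-1 : ℂ) ^ k * (-1 : ℂ) ^ i * Ring.choose (k : ℂ) i) •
        mode v (n + k - i) (mode u (m + i) w)
  /-- The Virasoro relations for `L(n) = ω_{n+1}`. -/
  virasoro (m n : ℤ) (v : V) :
    mode conf (m + 1) (mode conf (n + 1) v) - mode conf (n + 1) (mode conf (m + 1) v) =
      ((m : ℂ) - n) • mode conf (m + n + 1) v +
        if m + n = 0 then (((m : ℂ) ^ 3 - m) / 12 * charge) • v else 0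
  /-- `V_n` consists of eigenvectors of `L(0)` with eigenvalue `n`. -/
  L_zero (n : ℤ) (v : V) : v ∈ wt n → mode conf 1 v = (n : ℂ) • v
  /-- `Y(L(-1)u, z) = d/dz Y(u, z)`. -/
  L_neg_one (u : V) (n : ℤ) : mode (mode conf 0 u) n = (-(n : ℂ)) • mode u (n - 1)

namespace VertexOperatorAlgebra

variable {V : Type*} [AddCommGroup V] [Module ℂ V]

/-- The operator `L(n) = ω_{n+1}` on `V`. -/
def L (A : VertexOperatorAlgebra V) (n : ℤ) : Module.End ℂ V := A.mode A.conf (n + 1)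

/-- `V` is simple: it is nonzero and its only subspaces stable under all modes `u_n`, `u ∈ V`,
are `0` and `V`. -/
structure IsSimple (A : VertexOperatorAlgebra V) : Prop where
  nontrivial : Nontrivial V
  eq_bot_or_eq_top (I : Submodule ℂ V) :
    (∀ (u : V) (n : ℤ), ∀ v ∈ I, A.mode u n v ∈ I) → I = ⊥ ∨ I = ⊤

/-- `V` is of CFT type: it is simple, `V = ⨁_{n ≥ 0} V_n`, and `V_0` is one-dimensional. -/
structure IsCFTType (A : VertexOperatorAlgebra V) : Prop where
  isSimple : A.IsSimple
  wt_neg (n : ℤ) : n < 0 → A.wt n = ⊥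
  finrank_wt_zero : Module.finrank ℂ (A.wt 0) = 1

/-- Automorphisms of a vertex operator algebra. -/
structure IsAutomorphism (A : VertexOperatorAlgebra V) (g : V ≃ₗ[ℂ] V) : Prop where
  map_mode (u v : V) (n : ℤ) : g (A.mode u n v) = A.mode (g u) n (g v)
  map_vac : g A.vac = A.vac
  map_conf : g A.conf = A.conf

noncomputable instance (A : VertexOperatorAlgebra V) : DirectSum.Decomposition A.wt :=
  A.isInternal.chooseDecomposition

/-- The linear map sending a vector `v = ∑ v_n`, `v_n ∈ V_n`, to `∑ f n v_n`. -/
noncomputable def homogeneousLift {E : Type*} [AddCommGroup E] [Module ℂ E]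
    (A : VertexOperatorAlgebra V) (f : ℤ → V →ₗ[ℂ] E) : V →ₗ[ℂ] E :=
  DirectSum.toModule ℂ ℤ E (fun n => f n ∘ₗ (A.wt n).subtype) ∘ₗ
    (DirectSum.decomposeLinearEquiv A.wt : V →ₗ[ℂ] DirectSum ℤ fun n => A.wt n)

theorem homogeneousLift_apply {E : Type*} [AddCommGroup E] [Module ℂ E]
    (A : VertexOperatorAlgebra V) (f : ℤ → V →ₗ[ℂ] E) {n : ℤ} {v : V} (hv : v ∈ A.wt n) :
    A.homogeneousLift f v = f n v := by
  have h : DirectSum.decomposeLinearEquiv A.wt v =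
      DirectSum.lof ℂ ℤ (fun i => A.wt i) n ⟨v, hv⟩ := DirectSum.decompose_of_mem A.wt hv
  simp [homogeneousLift, h]

/-- A weak module `(M, Y_M)` for the vertex operator algebra `A`. -/
structure WeakModule (A : VertexOperatorAlgebra V) (M : Type*) [AddCommGroup M] [Module ℂ M] where
  /-- `mode u n` is the coefficient `u_n` of `z ^ (-n-1)` in `Y_M(u, z)`. -/
  mode : V →ₗ[ℂ] (ℤ → Module.End ℂ M)
  truncation (u : V) (w : M) : ∃ N : ℤ, ∀ n ≥ N, mode u n w = 0
  mode_vac (n : ℤ) (w : M) : mode A.vac n w = if n = -1 then w else 0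
  jacobi (u v : V) (w : M) (k m n : ℤ) :
    ∑ᶠ i : ℕ, Ring.choose (m : ℂ) i • mode (A.mode u (k + i) v) (m + n - i) w =
      ∑ᶠ i : ℕ, ((-1 : ℂ) ^ i * Ring.choose (k : ℂ) i) • mode u (m + k - i) (mode v (n + i) w) -
      ∑ᶠ i : ℕ, ((-1 : ℂ) ^ k * (-1 : ℂ) ^ i * Ring.choose (k : ℂ) i) •
        mode v (n + k - i) (mode u (m + i) w)

/-- `V` as a module for itself. -/
def adjoint (A : VertexOperatorAlgebra V) : A.WeakModule V where
  mode := A.mode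
  truncation := A.truncation
  mode_vac := A.mode_vac
  jacobi := A.jacobi

namespace WeakModule

variable {A : VertexOperatorAlgebra V} {M : Type*} [AddCommGroup M] [Module ℂ M]

/-- The zero mode `o(v)` on `M`: the linear extension of `o(v) = v_{wt v - 1}` for homogeneous
`v`. -/
noncomputable def zeroMode (N : A.WeakModule M) : V →ₗ[ℂ] Module.End ℂ M :=
  A.homogeneousLift fun n => LinearMap.proj (n - 1) ∘ₗ N.mode

theorem zeroMode_apply (N : A.WeakModule M) {n : ℤ} {v : V} (hv : v ∈ A.wt n) :
    N.zeroMode v = N.mode v (n - 1) := by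
  rw [zeroMode, homogeneousLift_apply A _ hv]
  rfl

/-- The `M`-radical `J_M(V) = {v ∈ V | o(v) = 0 on M}`. -/
noncomputable def radical (N : A.WeakModule M) : Submodule ℂ V := LinearMap.ker N.zeroMode

/-- `J_M(V)_{(0,1)} = (V_0 + V_1) ∩ J_M(V)`. -/
noncomputable def radicalZeroOne (N : A.WeakModule M) : Submodule ℂ V :=
  (A.wt 0 ⊔ A.wt 1) ⊓ N.radical

end WeakModule

/-- For `g` of finite order `T`, the eigenspace `V^r` of `g` with eigenvalue `e^{-2πir/T}`. -/
noncomputable def sector (g : V ≃ₗ[ℂ] V) (r : ℕ) : Submodule ℂ V :=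
  Module.End.eigenspace (g : Module.End ℂ V)
    (Complex.exp (-2 * Real.pi * Complex.I * r / orderOf g))

theorem mem_sector_zero {g : V ≃ₗ[ℂ] V} {v : V} : v ∈ sector g 0 ↔ g v = v := by
  simp [sector]

section FixedPoints

variable (A : VertexOperatorAlgebra V)

theorem mode_mem_sector_zero {g : V ≃ₗ[ℂ] V} (hg : A.IsAutomorphism g) {u v : V}
    (hu : u ∈ sector g 0) (hv : v ∈ sector g 0) (n : ℤ) : A.mode u n v ∈ sector g 0 := by
  rw [mem_sector_zero] at *
  rw [hg.map_mode, hu, hv]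

/-- The weight spaces are the full eigenspaces of `L(0)`. -/
theorem mem_wt_of_eigen {n : ℤ} {v : V} (h : A.mode A.conf 1 v = (n : ℂ) • v) : v ∈ A.wt n := by
  have key : ∀ (x : V) (m : ℤ), (DirectSum.decompose A.wt (A.mode A.conf 1 x) m : V) =
      (m : ℂ) • (DirectSum.decompose A.wt x m : V) := by
    intro x m
    induction x using DirectSum.Decomposition.inductionOn A.wt with
    | zero => simp
    | @homogeneous i y =>
      rw [A.L_zero i y y.2]
      by_cases hi : i = m
      · subst hi
        rw [DirectSum.decompose_of_mem_same _ y.2,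
          DirectSum.decompose_of_mem_same _ (Submodule.smul_mem _ _ y.2)]
      · rw [DirectSum.decompose_of_mem_ne _ y.2 hi,
          DirectSum.decompose_of_mem_ne _ (Submodule.smul_mem _ _ y.2) hi, smul_zero]
    | add x y hx hy => simp [DirectSum.decompose_add, hx, hy]
  have h0 : ∀ m, m ≠ n → (DirectSum.decompose A.wt v m : V) = 0 := by
    intro m hm
    have h1 := key v m
    have h3 : (DirectSum.decompose A.wt ((n : ℂ) • v) m : V) =
        (n : ℂ) • (DirectSum.decompose A.wt v m : V) := by
      have := (DirectSum.decomposeLinearEquiv A.wt).map_smul (n : ℂ) v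
      exact congrArg (fun x => ((x m : A.wt m) : V)) this
    rw [h, h3] at h1
    have h2 : ((n : ℂ) - m) • (DirectSum.decompose A.wt v m : V) = 0 := by
      rw [sub_smul, h1, sub_self]
    rcases smul_eq_zero.1 h2 with h4 | h4
    · exact absurd (by exact_mod_cast (sub_eq_zero.1 h4).symm) hm
    · exact h4
  classical
  have hv : v = (DirectSum.decompose A.wt v n : V) := by
    conv_lhs => rw [← DirectSum.sum_support_decompose A.wt v]
    refine Finset.sum_eq_single n (fun m _ hm => h0 m hm) (fun hn => ?_)
    simpa using hn
  rw [hv]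
  exact SetLike.coe_mem _

theorem map_mem_wt {g : V ≃ₗ[ℂ] V} (hg : A.IsAutomorphism g) {n : ℤ} {v : V} (hv : v ∈ A.wt n) :
    g v ∈ A.wt n := by
  apply A.mem_wt_of_eigen
  have := hg.map_mode A.conf v 1
  rw [hg.map_conf, A.L_zero n v hv, map_smul] at this
  exact this.symm

theorem decompose_mem_sector_zero {g : V ≃ₗ[ℂ] V} (hg : A.IsAutomorphism g) {v : V}
    (hv : v ∈ sector g 0) (n : ℤ) : (DirectSum.decompose A.wt v n : V) ∈ sector g 0 := by
  have key : ∀ x : V, (DirectSum.decompose A.wt (g x) n : V) = g (DirectSum.decompose A.wt x n) := by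
    intro x
    induction x using DirectSum.Decomposition.inductionOn A.wt with
    | zero => simp
    | @homogeneous i y =>
      by_cases hi : i = n
      · subst hi
        rw [DirectSum.decompose_of_mem_same _ y.2,
          DirectSum.decompose_of_mem_same _ (A.map_mem_wt hg y.2)]
      · rw [DirectSum.decompose_of_mem_ne _ y.2 hi,
          DirectSum.decompose_of_mem_ne _ (A.map_mem_wt hg y.2) hi, map_zero]
    | add x y hx hy => simp [DirectSum.decompose_add, hx, hy]
  rw [mem_sector_zero] at hv ⊢
  rw [← key, hv]

theorem isInternal_sector_zero {g : V ≃ₗ[ℂ] V} (hg : A.IsAutomorphism g) :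
    DirectSum.IsInternal fun n => (A.wt n).comap (sector g 0).subtype := by
  classical
  apply DirectSum.isInternal_submodule_of_iSupIndep_of_iSup_eq_top
  · let f : Module.End ℂ (sector g 0) := (A.mode A.conf 1).restrict fun _ hv =>
      A.mode_mem_sector_zero hg (mem_sector_zero.2 hg.map_conf) hv 1
    refine ((Module.End.eigenspaces_iSupIndep f).comp (f := fun n : ℤ => (n : ℂ))
      Int.cast_injective).mono fun n x hx => ?_
    exact Module.End.mem_eigenspace_iff.2 (Subtype.ext (A.L_zero n x hx))
  · rw [eq_top_iff]
    rintro ⟨v, hv⟩ -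
    have h : (⟨v, hv⟩ : sector g 0) = ∑ n ∈ (DirectSum.decompose A.wt v).support,
        ⟨(DirectSum.decompose A.wt v n : V), A.decompose_mem_sector_zero hg hv n⟩ := by
      apply Subtype.ext
      rw [AddSubmonoidClass.coe_finsetSum]
      exact (DirectSum.sum_support_decompose A.wt v).symm
    rw [h]
    exact Submodule.sum_mem _ fun n _ => Submodule.mem_iSup_of_mem n
      (SetLike.coe_mem (DirectSum.decompose A.wt v n))

/-- The fixed points `V^0` of an automorphism, as a vertex operator subalgebra of `V` with the same
vacuum and Virasoro vector. -/
noncomputable def fixedPoints (g : V ≃ₗ[ℂ] V) (hg : A.IsAutomorphism g) :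
    VertexOperatorAlgebra (sector g 0) where
  mode :=
    { toFun := fun u n => (A.mode u n).restrict fun _ hv => A.mode_mem_sector_zero hg u.2 hv n
      map_add' := fun u v => by
        ext n w
        simp
      map_smul' := fun c u => by
        ext n w
        simp }
  vac := ⟨A.vac, mem_sector_zero.2 hg.map_vac⟩
  conf := ⟨A.conf, mem_sector_zero.2 hg.map_conf⟩
  charge := A.charge
  wt := fun n => (A.wt n).comap (sector g 0).subtype
  isInternal := A.isInternal_sector_zero hg
  finiteDimensional n := by
    have := A.finiteDimensional n
    exact FiniteDimensional.of_injective
      (((sector g 0).subtype.comp ((A.wt n).comap (sector g 0).subtype).subtype).codRestrict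
        (A.wt n) fun x => x.2) fun x y h => by
          have := congrArg Subtype.val h
          exact Subtype.ext (Subtype.ext this)
  lower_bound := by
    obtain ⟨N, hN⟩ := A.lower_bound
    refine ⟨N, fun n hn => ?_⟩
    rw [hN n hn, eq_bot_iff]
    intro x hx
    simpa using hx
  vac_mem := A.vac_mem
  conf_mem := A.conf_mem
  truncation u v := by
    obtain ⟨N, hN⟩ := A.truncation u v
    exact ⟨N, fun n hn => Subtype.ext (hN n hn)⟩
  mode_vac n v := by
    apply Subtype.ext
    have := A.mode_vac n v
    split_ifs with h <;> simpa [h] using this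
  creation v := ⟨fun n hn => Subtype.ext ((A.creation v).1 n hn), Subtype.ext (A.creation v).2⟩
  jacobi u v w k m n := by
    have hinj : Function.Injective (sector g 0).subtype.toAddMonoidHom := Subtype.val_injective
    apply hinj
    rw [map_sub, AddMonoidHom.map_finsum_of_injective _ hinj,
      AddMonoidHom.map_finsum_of_injective _ hinj, AddMonoidHom.map_finsum_of_injective _ hinj]
    exact A.jacobi u v w k m n
  virasoro m n v := by
    apply Subtype.ext
    have := A.virasoro m n v
    split_ifs with h <;> simpa [h] using this
  L_zero n v hv := Subtype.ext (A.L_zero n v hv)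
  L_neg_one u n := by
    ext v
    have := congrArg (fun f => f (v : V)) (A.L_neg_one u n)
    simpa using this

end FixedPoints

/-- A weak `g`-twisted `V`-module `(M, Y_M)`, for an automorphism `g` of finite order
`T = orderOf g`. -/
structure TwistedModule (A : VertexOperatorAlgebra V) (g : V ≃ₗ[ℂ] V)
    (M : Type*) [AddCommGroup M] [Module ℂ M] where
  /-- `mode u n` is the coefficient `u_n` of `z ^ (-n-1)` in `Y_M(u, z)`. -/
  mode : V →ₗ[ℂ] (ℚ → Module.End ℂ M)
  /-- For `u ∈ V^r` only exponents `n ∈ r/T + ℤ` occur. -/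
  support (r : ℕ) (hr : r < orderOf g) (u : V) (hu : u ∈ sector g r) (n : ℚ) :
    (¬ ∃ p : ℤ, n = r / orderOf g + p) → mode u n = 0
  truncation (u : V) (w : M) : ∃ N : ℚ, ∀ n ≥ N, mode u n w = 0
  mode_vac (n : ℚ) (w : M) : mode A.vac n w = if n = -1 then w else 0
  /-- The twisted Jacobi identity for `u ∈ V^r`; the coefficients of `z₁ ^ (-m-1)` with
  `m ∉ r/T + ℤ` vanish on both sides. -/
  jacobi (r : ℕ) (hr : r < orderOf g) (u v : V) (hu : u ∈ sector g r) (w : M) (k : ℤ) (m n : ℚ)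
    (hm : ∃ p : ℤ, m = r / orderOf g + p) :
    ∑ᶠ i : ℕ, Ring.choose (m : ℂ) i • mode (A.mode u (k + i) v) (m + n - i) w =
      ∑ᶠ i : ℕ, ((-1 : ℂ) ^ i * Ring.choose (k : ℂ) i) • mode u (m + k - i) (mode v (n + i) w) -
      ∑ᶠ i : ℕ, ((-1 : ℂ) ^ k * (-1 : ℂ) ^ i * Ring.choose (k : ℂ) i) •
        mode v (n + k - i) (mode u (m + i) w)

/-- A weak `g`-twisted `V`-module, restricted to a weak `V^0`-module. -/
noncomputable def TwistedModule.restrict {A : VertexOperatorAlgebra V} {g : V ≃ₗ[ℂ] V}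
    {M : Type*} [AddCommGroup M] [Module ℂ M] (N : A.TwistedModule g M)
    (hg : A.IsAutomorphism g) (hfin : IsOfFinOrder g) : (A.fixedPoints g hg).WeakModule M where
  mode :=
    { toFun := fun u n => N.mode u n
      map_add' := fun u v => by
        ext n w
        simp
      map_smul' := fun c u => by
        ext n w
        simp }
  truncation u w := by
    obtain ⟨K, hK⟩ := N.truncation u w
    exact ⟨⌈K⌉, fun n hn => hK n ((Int.le_ceil K).trans (by exact_mod_cast hn))⟩
  mode_vac n w := by
    have := N.mode_vac n w
    have h : ((n : ℚ) = -1) ↔ n = -1 := by exact_mod_cast Iff.rfl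
    simpa only [h] using! this
  jacobi u v w k m n := by
    have := N.jacobi 0 hfin.orderOf_pos u v u.2 w k m n ⟨m, by simp⟩
    simp only [Rat.cast_intCast] at this
    convert this using 5 <;> simp [fixedPoints]

/-- An admissible `g`-twisted `V`-module: a weak `g`-twisted `V`-module with a grading
`M = ⨁_{n ≥ 0} M(n/T)` such that `M(0) ≠ 0` and `v_m M(q) ⊆ M(q + wt v - m - 1)` for homogeneous
`v`. The grading is indexed by `ℚ`, with `M(q) = 0` unless `q = n/T` for a natural number `n`. -/
structure AdmissibleTwistedModule (A : VertexOperatorAlgebra V) (g : V ≃ₗ[ℂ] V)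
    (M : Type*) [AddCommGroup M] [Module ℂ M] extends A.TwistedModule g M where
  grade : ℚ → Submodule ℂ M
  isInternal : DirectSum.IsInternal grade
  grade_support (q : ℚ) : (¬ ∃ n : ℕ, q = n / orderOf g) → grade q = ⊥
  grade_zero : grade 0 ≠ ⊥
  mode_mem_grade (k : ℤ) (v : V) (hv : v ∈ A.wt k) (m q : ℚ) (w : M) (hw : w ∈ grade q) :
    mode v m w ∈ grade (q + k - m - 1)

end VertexOperatorAlgebra

namespace VertexOperatorAlgebra

variable {V : Type*} [AddCommGroup V] [Module ℂ V]

/-! The inclusion of the right side in the left is the derivative property: on weight `i`, the zero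
mode of `L(0)v + L(-1)v` is `i v_{i-1} - i v_{i-1}`.

Conversely, modulo `(L(0) + L(-1))V^0` a vector of positive weight `n` equals `-L(-1)/n` of itself,
so weights can be raised to a common one and `v ≡ c + y` with `c` a multiple of the vacuum and `y`
homogeneous of weight `n + 1`. If `v` is in the radical, `y_n` is then scalar on `M`, so it commutes
with every `u_q`, `u ∈ V`. The commutator formula gives `∑ C(n,i) (y_i u)_{n+q-i} = 0`. The `y_i u`
have distinct weights, so brackets with `L(-1)` and `L(0)` separate the terms
(`mode_eq_zero_of_sum_eq_zero`). Simplicity of `V` makes `Y_M` injective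
(`eq_zero_of_mode_eq_zero`), hence `y_i u = 0` for `0 ≤ i ≤ n`.

For `u = ω`, skew symmetry expresses `(n + 1) y = ω_1 y` through the single vector `y_{n+1} ω` of
weight one (`exists_mem_wt_one_sub_mem`), so `y` reduces to weight one. For `n = 0`, `y_0 = 0` is
the second claim. -/

theorem finsum_choose_zero_smul {E : Type*} [AddCommGroup E] [Module ℂ E] (c : ℕ → ℂ) (f : ℕ → E) :
    ∑ᶠ i : ℕ, (c i * Ring.choose (0 : ℂ) i) • f i = c 0 • f 0 := by
  rw [finsum_eq_single _ 0 fun i hi => by rw [Ring.choose_zero_pos ℂ (Nat.pos_of_ne_zero hi)]; simp]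
  simp

/-! ### Commutators, weights and skew symmetry in the algebra itself. -/

section Basic

variable (A : VertexOperatorAlgebra V)

/-- The commutator formula for `[u_m, v_n]`, `m ≥ 0`. -/
theorem commutator (u v w : V) (m : ℕ) (n : ℤ) :
    A.mode u m (A.mode v n w) - A.mode v n (A.mode u m w) =
      ∑ i ∈ Finset.range (m + 1), (m.choose i : ℂ) • A.mode (A.mode u i v) (m + n - i) w := by
  have h := A.jacobi u v w 0 m n
  simp only [Int.cast_zero, zero_add, Int.cast_natCast, Ring.choose_natCast, zpow_zero, one_mul,
    finsum_choose_zero_smul] at h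
  rw [finsum_eq_sum_of_support_subset (s := Finset.range (m + 1))] at h
  · simpa using h.symm
  · intro i hi
    by_contra hlt
    simp only [Finset.coe_range, Set.mem_Iio, not_lt] at hlt
    exact hi (by simp [Nat.choose_eq_zero_of_lt (show m < i by omega)])

/-- `[L(0), u_n] = (L(-1)u)_{n+1} + (L(0)u)_n` makes `u_n v` an eigenvector of `L(0)`, and weight
spaces are full eigenspaces. -/
theorem mode_mem_wt {p k : ℤ} {u v : V} (hu : u ∈ A.wt p) (hv : v ∈ A.wt k) (n : ℤ) :
    A.mode u n v ∈ A.wt (p + k - n - 1) := by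
  apply A.mem_wt_of_eigen
  have h := A.commutator A.conf u v 1 n
  have h1 := congrArg (fun f => f v) (A.L_neg_one u (1 + n))
  simp only [Finset.sum_range_succ, Finset.sum_range_zero, zero_add, Nat.choose_zero_right,
    Nat.choose_self, Nat.cast_one, Nat.cast_zero, one_smul, sub_zero, LinearMap.smul_apply,
    add_sub_cancel_left, A.L_zero p u hu, A.L_zero k v hv, map_smul, Pi.smul_apply] at h h1
  rw [h1, sub_eq_iff_eq_add] at h
  rw [h]
  push_cast
  module

theorem mode_conf_zero_mem_wt {p : ℤ} {u : V} (hu : u ∈ A.wt p) :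
    A.mode A.conf 0 u ∈ A.wt (p + 1) := by
  have := A.mode_mem_wt A.conf_mem hu 0
  rwa [show 2 + p - 0 - 1 = p + 1 by ring] at this

theorem mode_neg_two_vac (u : V) : A.mode u (-2) A.vac = A.mode A.conf 0 u := by
  have h := congrArg (fun f => f A.vac) (A.L_neg_one u (-1))
  simpa [(A.creation (A.mode A.conf 0 u)).2] using h.symm

theorem mode_conf_zero_mode_vac (u : V) (n : ℤ) :
    A.mode A.conf 0 (A.mode u n A.vac) = (-(n : ℂ)) • A.mode u (n - 1) A.vac := by
  have h := A.commutator A.conf u A.vac 0 n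
  have h1 := congrArg (fun f => f A.vac) (A.L_neg_one u n)
  simp only [Nat.cast_zero, (A.creation A.conf).1 0 le_rfl, map_zero, sub_zero] at h
  simpa [h1] using h

theorem choose_neg_one (i : ℕ) : Ring.choose (-1 : ℂ) i = (-1 : ℂ) ^ i := by
  induction i with
  | zero => simp
  | succ i ih =>
    have h := Ring.choose_succ_succ (-1 : ℂ) i
    rw [neg_add_cancel, Ring.choose_zero_succ, ih] at h
    rw [pow_succ, mul_neg_one]
    exact (neg_eq_of_add_eq_zero_right h.symm).symm

/-- Skew symmetry. -/
theorem skew_symmetry (u v : V) (k : ℤ) :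
    A.mode v k u = (-(-1 : ℂ) ^ k) •
      ∑ᶠ i : ℕ, ((-1 : ℂ) ^ i) • A.mode (A.mode u (k + i) v) (-1 - i) A.vac := by
  -- On the vacuum with `m = -1`, `n = 0`, creation kills the first sum on the right and leaves only
  -- `i = 0` in the second.
  have h := A.jacobi u v A.vac k (-1) 0
  have hsum : ∑ᶠ i : ℕ, ((-1 : ℂ) ^ i * Ring.choose (k : ℂ) i) •
      A.mode u (-1 + k - i) (A.mode v (0 + i) A.vac) = 0 := by
    rw [finsum_eq_zero_of_forall_eq_zero]
    intro i
    rw [(A.creation v).1 _ (by omega), map_zero, smul_zero]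
  have hsum' : ∑ᶠ i : ℕ, ((-1 : ℂ) ^ k * (-1 : ℂ) ^ i * Ring.choose (k : ℂ) i) •
      A.mode v (0 + k - i) (A.mode u (-1 + i) A.vac) = (-1 : ℂ) ^ k • A.mode v k u := by
    rw [finsum_eq_single _ 0 fun i hi => by
      rw [(A.creation u).1 _ (by omega), map_zero, smul_zero]]
    simp [(A.creation u).2]
  rw [hsum, hsum', zero_sub] at h
  simp only [Int.cast_neg, Int.cast_one, choose_neg_one, add_zero] at h
  rw [h, smul_neg, neg_smul, neg_neg, smul_smul, ← zpow_add₀ (by norm_num),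
    Even.neg_one_zpow ⟨k, rfl⟩, one_smul]

/-! ### Reduction modulo `(L(0) + L(-1)) V`. -/

/-- The subspace `(L(0) + L(-1)) V`. -/
noncomputable def rangeL : Submodule ℂ V := LinearMap.range (A.L 0 + A.L (-1))

theorem mem_rangeL_of_mem_wt {n : ℤ} {z : V} (hz : z ∈ A.wt n) :
    (n : ℂ) • z + A.mode A.conf 0 z ∈ A.rangeL :=
  ⟨z, by simp [L, A.L_zero n z hz]⟩

/-- `L(0)` is invertible on nonzero weight, so `z` can be traded for `-L(-1)z / n`. -/
theorem exists_mem_wt_succ_sub_mem {n : ℕ} (hn : n ≠ 0) {z : V} (hz : z ∈ A.wt n) :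
    ∃ y ∈ A.wt (n + 1), z - y ∈ A.rangeL := by
  refine ⟨(-(n : ℂ)⁻¹) • A.mode A.conf 0 z,
    Submodule.smul_mem _ _ (A.mode_conf_zero_mem_wt hz), ?_⟩
  have h := A.rangeL.smul_mem (n : ℂ)⁻¹ (A.mem_rangeL_of_mem_wt hz)
  have hn' : (n : ℂ) ≠ 0 := Nat.cast_ne_zero.2 hn
  rw [smul_add, Int.cast_natCast, inv_smul_smul₀ hn'] at h
  simpa using h

theorem exists_mem_wt_add_sub_mem {n : ℕ} (hn : n ≠ 0) {z : V} (hz : z ∈ A.wt n) (d : ℕ) :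
    ∃ y ∈ A.wt (n + d : ℕ), z - y ∈ A.rangeL := by
  induction d with
  | zero => exact ⟨z, hz, by simp⟩
  | succ d ih =>
    obtain ⟨y, hy, h⟩ := ih
    obtain ⟨x, hx, h'⟩ := A.exists_mem_wt_succ_sub_mem (by omega) hy
    exact ⟨x, by exact_mod_cast hx, by simpa using add_mem h h'⟩

/-- Modulo `(L(0) + L(-1)) V`, every vector is the sum of a vector of weight zero and a homogeneous
vector of positive weight. -/
theorem exists_sub_mem_rangeL (hneg : ∀ n < 0, A.wt n = ⊥) (v : V) :
    ∃ (n : ℕ) (c y : V), c ∈ A.wt 0 ∧ y ∈ A.wt (n + 1 : ℕ) ∧ v - (c + y) ∈ A.rangeL := by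
  induction v using DirectSum.Decomposition.inductionOn A.wt with
  | zero => exact ⟨0, 0, 0, by simp⟩
  | @homogeneous i y =>
    obtain ⟨y, hy⟩ := y
    rcases lt_trichotomy i 0 with hi | rfl | hi
    · rw [hneg i hi, Submodule.mem_bot] at hy
      exact ⟨0, 0, 0, by simp [hy]⟩
    · exact ⟨0, y, 0, hy, by simp, by simp⟩
    · obtain ⟨n, rfl⟩ : ∃ n : ℕ, i = (n + 1 : ℕ) := ⟨(i - 1).toNat, by omega⟩
      exact ⟨n, 0, y, by simp, hy, by simp⟩
  | add v w hv hw =>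
    obtain ⟨n, c, y, hc, hy, h⟩ := hv
    obtain ⟨n', c', y', hc', hy', h'⟩ := hw
    -- Raising each positive part by the other's offset brings both to weight `n + n' + 1`, so their
    -- sum is again homogeneous.
    obtain ⟨x, hx, hyx⟩ := A.exists_mem_wt_add_sub_mem n.succ_ne_zero hy n'
    obtain ⟨x', hx', hyx'⟩ := A.exists_mem_wt_add_sub_mem n'.succ_ne_zero hy' n
    refine ⟨n + n', c + c', x + x', add_mem hc hc', add_mem ?_ ?_, ?_⟩
    · rwa [show n + n' + 1 = n + 1 + n' by ring]
    · rwa [show n + n' + 1 = n' + 1 + n by ring]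
    · convert add_mem (add_mem h h') (add_mem hyx hyx') using 1
      abel

/-- Since `x_{-1-n} 𝟏 = L(-1)^n x / n!`, and each `L(-1)` on weight `k` acts as `-k` modulo the
range, the result is `(-1)^n x`. -/
theorem exists_mem_wt_one_mode_vac_sub_mem {x : V} (hx : x ∈ A.wt 1) (n : ℕ) :
    ∃ z ∈ A.wt 1, A.mode x (-1 - n) A.vac - z ∈ A.rangeL := by
  induction n with
  | zero => exact ⟨x, hx, by simp [(A.creation x).2]⟩
  | succ n ih =>
    obtain ⟨z, hz, h⟩ := ih
    refine ⟨-z, neg_mem hz, ?_⟩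
    have hwt := A.mode_mem_wt hx A.vac_mem (-1 - n)
    have h1 := A.mem_rangeL_of_mem_wt hwt
    rw [mode_conf_zero_mode_vac] at h1
    have hn : ((n : ℂ) + 1) ≠ 0 := Nat.cast_add_one_ne_zero n
    have h2 := sub_mem (A.rangeL.smul_mem ((n : ℂ) + 1)⁻¹ h1) h
    convert h2 using 1
    push_cast
    rw [show (1 : ℂ) - (-1 - n) - 1 = n + 1 by ring, show -(-1 - (n : ℂ)) = n + 1 by ring,
      ← smul_add, inv_smul_smul₀ hn, show (-1 - (n + 1) : ℤ) = -1 - n - 1 by ring]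
    abel

/-- If `y_j ω = 0` for all `0 ≤ j ≤ n`, where `y` has weight `n + 1`, then `y` is congruent to a
vector of weight one modulo `(L(0) + L(-1)) V`. -/
theorem exists_mem_wt_one_sub_mem (hneg : ∀ n < 0, A.wt n = ⊥)
    (hvac : ∀ c ∈ A.wt 0, ∃ a : ℂ, c = a • A.vac) {n : ℕ} {y : V} (hy : y ∈ A.wt (n + 1 : ℕ))
    (h : ∀ j ≤ n, A.mode y j A.conf = 0) : ∃ x ∈ A.wt 1, y - x ∈ A.rangeL := by
  have hwt (i : ℕ) : A.mode y (1 + i) A.conf ∈ A.wt (n + 1 - i) := by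
    have := A.mode_mem_wt hy A.conf_mem (1 + i)
    rwa [show ((n + 1 : ℕ) : ℤ) + 2 - (1 + i) - 1 = n + 1 - i by push_cast; ring] at this
  -- The left side is `ω_1 y = (n + 1) y`; only the term `i = n`, built on `y_{n+1} ω`, survives on
  -- the right.
  have hs := A.skew_symmetry y A.conf 1
  rw [A.L_zero _ _ hy, finsum_eq_single _ n] at hs
  · have hx := hwt n
    rw [add_sub_cancel_left] at hx
    obtain ⟨z, hz, hm⟩ := A.exists_mem_wt_one_mode_vac_sub_mem hx n
    have hn : ((n : ℂ) + 1) ≠ 0 := Nat.cast_add_one_ne_zero n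
    refine ⟨(((n : ℂ) + 1)⁻¹ * (-1) ^ n) • z, Submodule.smul_mem _ _ hz, ?_⟩
    convert A.rangeL.smul_mem (((n : ℂ) + 1)⁻¹ * (-1) ^ n) hm using 1
    rw [smul_sub, mul_smul _ _ (A.mode _ _ A.vac)]
    congr 1
    rw [eq_inv_smul_iff₀ hn]
    simpa using hs
  · intro i hi
    rcases lt_or_gt_of_ne hi with hi | hi
    · have := h (1 + i) (by omega)
      push_cast at this
      simp [this]
    · have hw := hwt i
      rcases (show n + 1 ≤ i from hi).eq_or_lt with rfl | hi
      · rw [show (n : ℤ) + 1 - (n + 1 : ℕ) = 0 by push_cast; ring] at hw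
        obtain ⟨a, ha⟩ := hvac _ hw
        -- `y_{n+2} ω` is a multiple of the vacuum, whose only nonzero mode is `-1`; the mode here
        -- is `-n - 2`.
        rw [ha, map_smul, Pi.smul_apply, LinearMap.smul_apply, A.mode_vac, if_neg (by omega)]
        simp
      · rw [hneg _ (by omega), Submodule.mem_bot] at hw
        simp [hw]

end Basic

/-! ### The easy inclusion, for any weak module. -/

namespace WeakModule

variable {A : VertexOperatorAlgebra V} {M : Type*} [AddCommGroup M] [Module ℂ M]

/-- The derivative property `Y_M(L(-1)u, z) = d/dz Y_M(u, z)`. -/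
theorem mode_mode_conf_zero (N : A.WeakModule M) (u : V) (m : ℤ) (w : M) :
    N.mode (A.mode A.conf 0 u) m w = (-(m : ℂ)) • N.mode u (m - 1) w := by
  -- With `k = -2` and `n = 0` the mode `-1` of the vacuum never occurs on the right, while the left
  -- is `(u_{-2} 𝟏)_m + m u_{m-1}`.
  have h := N.jacobi u A.vac w (-2) m 0
  have h1 : ∑ᶠ i : ℕ, ((-1 : ℂ) ^ i * Ring.choose ((-2 : ℤ) : ℂ) i) •
      N.mode u (m + -2 - i) (N.mode A.vac (0 + i) w) = 0 := by
    rw [finsum_eq_zero_of_forall_eq_zero]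
    intro i
    rw [N.mode_vac, if_neg (by omega), map_zero, smul_zero]
  have h2 : ∑ᶠ i : ℕ, ((-1 : ℂ) ^ (-2 : ℤ) * (-1 : ℂ) ^ i * Ring.choose ((-2 : ℤ) : ℂ) i) •
      N.mode A.vac (0 + -2 - i) (N.mode u (m + i) w) = 0 := by
    rw [finsum_eq_zero_of_forall_eq_zero]
    intro i
    rw [N.mode_vac, if_neg (by omega), smul_zero]
  rw [h1, h2, sub_zero, finsum_eq_sum_of_support_subset (s := Finset.range 2)] at h
  · simp only [Finset.sum_range_succ, Finset.sum_range_zero, Nat.cast_zero, Nat.cast_one, add_zero,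
      zero_add, sub_zero, Ring.choose_zero_right, Ring.choose_one_right, one_smul,
      A.mode_neg_two_vac, show (-2 + 1 : ℤ) = -1 from rfl, (A.creation u).2] at h
    rw [neg_smul]
    exact eq_neg_of_add_eq_zero_left h
  · intro i hi
    by_contra hlt
    simp only [Finset.coe_range, Set.mem_Iio, not_lt] at hlt
    exact hi (by simp [(A.creation u).1 (-2 + i) (by omega)])

theorem rangeL_le_radical (N : A.WeakModule M) : A.rangeL ≤ N.radical := by
  rintro _ ⟨v, rfl⟩
  induction v using DirectSum.Decomposition.inductionOn A.wt with
  | zero => simp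
  | @homogeneous i y =>
    obtain ⟨y, hy⟩ := y
    simp only [radical, LinearMap.mem_ker, LinearMap.add_apply, map_add, L, zero_add,
      neg_add_cancel, A.L_zero i y hy, map_smul]
    rw [N.zeroMode_apply hy, N.zeroMode_apply (A.mode_conf_zero_mem_wt hy)]
    ext w
    simp [mode_mode_conf_zero]
  | add v w hv hw => rw [map_add]; exact add_mem hv hw

end WeakModule

/-! ### Eigenspace decomposition for an automorphism of finite order. -/

section Sectors

theorem exp_pow_eq (T : ℕ) (k : ℕ) :
    Complex.exp (2 * Real.pi * Complex.I / T) ^ k =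
      Complex.exp (2 * Real.pi * Complex.I * k / T) := by
  rw [← Complex.exp_nat_mul]
  congr 1
  ring

/-- An automorphism of finite order is diagonalizable. -/
theorem iSup_sector_eq_top {g : V ≃ₗ[ℂ] V} (hfin : IsOfFinOrder g) :
    ⨆ r : Fin (orderOf g), sector g r = ⊤ := by
  set T := orderOf g with hT
  have hT0 : T ≠ 0 := hfin.orderOf_pos.ne'
  have hTC : (T : ℂ) ≠ 0 := Nat.cast_ne_zero.2 hT0
  set ζ : ℂ := Complex.exp (2 * Real.pi * Complex.I / T) with hζ
  have hprim : IsPrimitiveRoot ζ T := Complex.isPrimitiveRoot_exp T hT0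
  rw [eq_top_iff]
  rintro v -
  -- `p r` is `T` times the projection of `v` to the sector `r`, by averaging over the cyclic group.
  let p (r : ℕ) : V := ∑ s ∈ Finset.range T, (ζ ^ r) ^ s • (g ^ s) v
  have hp (r : ℕ) : p r ∈ sector g r := by
    rw [sector, Module.End.mem_eigenspace_iff]
    have hinv : Complex.exp (-2 * Real.pi * Complex.I * r / orderOf g) * ζ ^ r = 1 := by
      rw [hζ, exp_pow_eq, ← hT, ← Complex.exp_add, Complex.exp_eq_one_iff]
      exact ⟨0, by push_cast; ring⟩
    set c := Complex.exp (-2 * Real.pi * Complex.I * r / orderOf g)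
    let f (s : ℕ) : V := (c * (ζ ^ r) ^ s) • (g ^ s) v
    have hleft : (g : Module.End ℂ V) (p r) = ∑ s ∈ Finset.range T, f (s + 1) := by
      simp only [p, map_sum, map_smul, f]
      refine Finset.sum_congr rfl fun s _ => ?_
      rw [pow_succ', ← mul_assoc, hinv, one_mul, pow_succ']
      rfl
    have hright : c • p r = ∑ s ∈ Finset.range T, f s := by
      simp only [p, f, Finset.smul_sum, smul_smul]
    have hper : f T = f 0 := by
      simp only [f]
      rw [← pow_mul, mul_comm r T, pow_mul, hprim.pow_eq_one, hT, pow_orderOf_eq_one]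
      simp
    rw [hleft, hright]
    have h1 := Finset.sum_range_succ f T
    have h2 := Finset.sum_range_succ' f T
    rw [h1, hper] at h2
    exact (add_right_cancel h2).symm
  have hsum : ∑ r ∈ Finset.range T, p r = (T : ℂ) • v := by
    simp only [p]
    rw [Finset.sum_comm]
    simp only [← Finset.sum_smul]
    rw [Finset.sum_eq_single 0]
    · simp
    · intro s hs hs0
      have h1 : ∑ r ∈ Finset.range T, (ζ ^ r) ^ s = ∑ r ∈ Finset.range T, (ζ ^ s) ^ r :=
        Finset.sum_congr rfl fun r _ => by rw [← pow_mul, ← pow_mul, mul_comm]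
      have h2 : ζ ^ s ≠ 1 :=
        hprim.pow_ne_one_of_pos_of_lt hs0 (Finset.mem_range.1 hs)
      rw [h1, geom_sum_eq h2, ← pow_mul, mul_comm s T, pow_mul, hprim.pow_eq_one]
      simp
    · intro h
      exact absurd (Finset.mem_range.2 (Nat.pos_of_ne_zero hT0)) h
  rw [← inv_smul_smul₀ hTC v, ← hsum]
  refine Submodule.smul_mem _ _ (Submodule.sum_mem _ fun r hr => ?_)
  exact Submodule.mem_iSup_of_mem (⟨r, Finset.mem_range.1 hr⟩ : Fin T) (hp r)

end Sectors

/-! ### Injectivity of `Y_M` and separation of weights on twisted modules. -/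

namespace TwistedModule

variable {A : VertexOperatorAlgebra V} {g : V ≃ₗ[ℂ] V} {M : Type*} [AddCommGroup M] [Module ℂ M]

/-- The commutator formula for `[u_m, v_n]` on a twisted module, `g u = u` and `m ≥ 0`. -/
theorem commutator (N : A.TwistedModule g M) (hfin : IsOfFinOrder g) {u : V} (hu : u ∈ sector g 0)
    (v : V) (w : M) (m : ℕ) (n : ℚ) :
    N.mode u m (N.mode v n w) - N.mode v n (N.mode u m w) =
      ∑ i ∈ Finset.range (m + 1), (m.choose i : ℂ) • N.mode (A.mode u i v) (m + n - i) w := by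
  have h := N.jacobi 0 hfin.orderOf_pos u v hu w 0 m n ⟨m, by simp⟩
  simp only [Int.cast_zero, zero_add, Rat.cast_natCast, Ring.choose_natCast, zpow_zero, one_mul,
    finsum_choose_zero_smul] at h
  rw [finsum_eq_sum_of_support_subset (s := Finset.range (m + 1))] at h
  · simpa using h.symm
  · intro i hi
    by_contra hlt
    simp only [Finset.coe_range, Set.mem_Iio, not_lt] at hlt
    exact hi (by simp [Nat.choose_eq_zero_of_lt (show m < i by omega)])

/-- Downward induction on `k` from truncation: if `x` acts as zero, the right side of the Jacobi
identity vanishes, and on the left all terms but `i = 0` involve higher `u_{k+i} x`. -/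
theorem mode_mode_eq_zero (N : A.TwistedModule g M) {x : V}
    (hx : ∀ (q : ℚ) (w : M), N.mode x q w = 0) {r : ℕ} (hr : r < orderOf g) {u : V}
    (hu : u ∈ sector g r) (k : ℤ) (q : ℚ) (w : M) : N.mode (A.mode u k x) q w = 0 := by
  obtain ⟨K, hK⟩ := A.truncation u x
  have key : ∀ (d : ℕ) (k : ℤ), K ≤ k + d → ∀ (q : ℚ) (w : M),
      N.mode (A.mode u k x) q w = 0 := by
    intro d
    induction d with
    | zero =>
      intro k hk q w
      rw [hK k (by simpa using hk)]
      simp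
    | succ d ih =>
      intro k hk q w
      -- `m = r/T` lies in the coset required for `u`, and `n = q - r/T` puts the leading term at
      -- mode `q`.
      have h := N.jacobi r hr u x hu w k (r / orderOf g) (q - r / orderOf g) ⟨0, by simp⟩
      simp only [hx, map_zero, smul_zero, finsum_zero, sub_zero] at h
      rw [finsum_eq_single _ 0] at h
      · simpa using h
      · intro i hi
        rw [ih (k + i) (by push_cast at hk; omega), smul_zero]
  exact key (K - k).toNat k (by omega) q w

/-- On a nonzero twisted module for a simple vertex operator algebra, `Y_M` is injective. -/
theorem eq_zero_of_mode_eq_zero [Nontrivial M] (N : A.TwistedModule g M) (hA : A.IsSimple)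
    (hfin : IsOfFinOrder g) {x : V} (hx : ∀ (q : ℚ) (w : M), N.mode x q w = 0) : x = 0 := by
  let I : Submodule ℂ V := LinearMap.ker N.mode
  have hI {y : V} : y ∈ I ↔ ∀ (q : ℚ) (w : M), N.mode y q w = 0 := by
    refine ⟨fun h q w => ?_, fun h => ?_⟩
    · rw [LinearMap.mem_ker.1 h]; simp
    · exact LinearMap.mem_ker.2 (funext fun q => LinearMap.ext fun w => h q w)
  have hideal (u : V) (n : ℤ) (v : V) (hv : v ∈ I) : A.mode u n v ∈ I := by
    -- The twisted Jacobi identity is available only for eigenvectors of `g`, which span `V`.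
    have hu : u ∈ ⨆ r : Fin (orderOf g), sector g r := by
      rw [iSup_sector_eq_top hfin]
      trivial
    induction hu using Submodule.iSup_induction' with
    | mem r u hu =>
      exact hI.2 fun q w => N.mode_mode_eq_zero (hI.1 hv) r.2 hu n q w
    | zero => simp
    | add u u' _ _ h h' => simpa using add_mem h h'
  rcases hA.eq_bot_or_eq_top I hideal with h | h
  · exact (Submodule.mem_bot ℂ).1 (h ▸ hI.2 hx)
  · obtain ⟨w, hw⟩ := exists_ne (0 : M)
    have := hI.1 (h ▸ Submodule.mem_top : A.vac ∈ I) (-1) w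
    rw [N.mode_vac, if_pos rfl] at this
    exact absurd this hw

/-- If `∑ Y_M(x i, z) z ^ i = 0` for finitely many vectors `x i` of weight `K - i`, then
`Y_M(x i, z) = 0` for all `i`. -/
theorem mode_eq_zero_of_sum_eq_zero (N : A.TwistedModule g M) (hfin : IsOfFinOrder g)
    (hconf : A.conf ∈ sector g 0) (K : ℤ) (S : Finset ℕ) (x : ℕ → V)
    (hx : ∀ i : ℕ, x i ∈ A.wt (K - i))
    (h : ∀ (q : ℚ) (w : M), ∑ i ∈ S, N.mode (x i) (q - i) w = 0) :
    ∀ i ∈ S, ∀ (q : ℚ) (w : M), N.mode (x i) q w = 0 := by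
  induction S using Finset.induction_on generalizing x with
  | empty => simp
  | insert a S ha ih =>
    -- Bracket with `L(-1) = ω_0`.
    have h0 (q : ℚ) (w : M) :
        ∑ i ∈ insert a S, N.mode (A.mode A.conf 0 (x i)) (q - i) w = 0 := by
      have := congrArg (N.mode A.conf (0 : ℕ)) (h q w)
      rw [map_zero, map_sum] at this
      rw [← this, ← sub_zero (∑ i ∈ insert a S, N.mode A.conf _ _),
        ← h q (N.mode A.conf (0 : ℕ) w), ← Finset.sum_sub_distrib]
      refine Finset.sum_congr rfl fun i _ => ?_
      rw [N.commutator hfin hconf]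
      simp
    -- Bracket with `L(0) = ω_1`: besides the weights it yields the `L(-1)` terms at mode `1 + q -
    -- i`, which `h0` cancels.
    have h1 (q : ℚ) (w : M) :
        ∑ i ∈ insert a S, ((K : ℂ) - i) • N.mode (x i) (q - i) w = 0 := by
      have := congrArg (N.mode A.conf (1 : ℕ)) (h q w)
      rw [map_zero, map_sum] at this
      rw [← this, ← sub_zero (∑ i ∈ insert a S, N.mode A.conf _ _),
        ← h q (N.mode A.conf (1 : ℕ) w), ← Finset.sum_sub_distrib,
        ← add_zero (∑ i ∈ insert a S, ((K : ℂ) - i) • _), ← h0 (1 + q) w,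
        ← Finset.sum_add_distrib]
      refine Finset.sum_congr rfl fun i _ => ?_
      rw [N.commutator hfin hconf]
      have hL := A.L_zero _ _ (hx i)
      push_cast at hL
      rw [add_sub_assoc 1 q, add_comm]
      simp [Finset.sum_range_succ, hL]
    have h2 : ∀ i ∈ S, ∀ (q : ℚ) (w : M), N.mode (x i) q w = 0 := by
      intro i hi q w
      -- Subtracting `K - a` times the relation from its weighted form removes `x a` and rescales
      -- each other `x i` by the nonzero `a - i`.
      have := ih (fun i => ((a : ℂ) - i) • x i) (fun i => Submodule.smul_mem _ _ (hx i))
        (fun q w => ?_) i hi q w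
      · have hne : (a : ℂ) - i ≠ 0 :=
          sub_ne_zero.2 fun h => ha (by rwa [Nat.cast_injective h])
        simpa [hne] using this
      · have e1 := h1 q w
        have e2 := congrArg (((K : ℂ) - a) • ·) (h q w)
        rw [Finset.sum_insert ha] at e1
        simp only [Finset.sum_insert ha, smul_add, smul_zero] at e2
        have e3 := e1.trans e2.symm
        rw [add_right_inj, Finset.smul_sum, ← sub_eq_zero, ← Finset.sum_sub_distrib] at e3
        rw [← e3]
        refine Finset.sum_congr rfl fun i _ => ?_
        rw [← sub_smul]
        simp
    intro i hi q w
    rcases Finset.mem_insert.1 hi with rfl | hi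
    · have := h (q + i) w
      rw [Finset.sum_insert ha, Finset.sum_eq_zero fun j hj => h2 j hj _ w, add_zero] at this
      simpa using this
    · exact h2 i hi q w

/-- If `y` has weight `n + 1` and `o(y)` is scalar on `M`, then `y_j = 0` on `V` for all
`0 ≤ j ≤ n`. -/
theorem mode_eq_zero_of_zeroMode_scalar [Nontrivial M] (N : A.TwistedModule g M) (hA : A.IsSimple)
    (hfin : IsOfFinOrder g) (hconf : A.conf ∈ sector g 0) {n : ℕ} {y : V}
    (hy : y ∈ A.wt (n + 1 : ℕ)) (hyg : y ∈ sector g 0) {c : ℂ}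
    (hc : ∀ w : M, N.mode y n w = c • w) {j : ℕ} (hj : j ≤ n) (u : V) : A.mode y j u = 0 := by
  induction u using DirectSum.Decomposition.inductionOn A.wt with
  | zero => simp
  | @homogeneous k u =>
    obtain ⟨u, hu⟩ := u
    -- The binomial coefficients are absorbed into the vectors; they are nonzero for `j ≤ n`.
    have h := N.mode_eq_zero_of_sum_eq_zero hfin hconf (n + k) (Finset.range (n + 1))
      (fun i => (n.choose i : ℂ) • A.mode y i u) (fun i => ?_) (fun q w => ?_) j
      (Finset.mem_range.2 (by omega))
    · have h0 := N.eq_zero_of_mode_eq_zero hA hfin h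
      have : (n.choose j : ℂ) ≠ 0 := Nat.cast_ne_zero.2 (Nat.choose_pos hj).ne'
      exact (smul_eq_zero.1 h0).resolve_left this
    · have := A.mode_mem_wt hy hu i
      rw [show ((n + 1 : ℕ) : ℤ) + k - i - 1 = n + k - i by push_cast; ring] at this
      exact Submodule.smul_mem _ _ this
    · have := N.commutator hfin hyg u w n (q - n)
      rw [hc, hc, map_smul, sub_self] at this
      simpa using this.symm
  | add u v hu hv => rw [map_add, hu, hv, add_zero]

end TwistedModule

theorem IsCFTType.exists_eq_smul_vac {A : VertexOperatorAlgebra V} (hA : A.IsCFTType) {c : V}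
    (hc : c ∈ A.wt 0) : ∃ a : ℂ, c = a • A.vac := by
  have := hA.isSimple.nontrivial
  have hne : (⟨A.vac, A.vac_mem⟩ : A.wt 0) ≠ 0 := by
    intro h
    obtain ⟨v, hv⟩ := exists_ne (0 : V)
    have h1 := A.mode_vac (-1) v
    rw [if_pos rfl, show A.vac = 0 from congrArg Subtype.val h] at h1
    exact hv (by simpa using h1.symm)
  obtain ⟨a, ha⟩ := (finrank_eq_one_iff_of_nonzero' _ hne).1 hA.finrank_wt_zero ⟨c, hc⟩
  exact ⟨a, (congrArg Subtype.val ha).symm⟩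

/-! ### Application to the fixed-point subalgebra. -/

section

variable {M : Type*} [AddCommGroup M] [Module ℂ M] {A : VertexOperatorAlgebra V}
  {g : V ≃ₗ[ℂ] V}

theorem AdmissibleTwistedModule.nontrivial (N : A.AdmissibleTwistedModule g M) : Nontrivial M := by
  obtain ⟨w, -, hw⟩ := (Submodule.ne_bot_iff _).1 N.grade_zero
  exact ⟨w, 0, hw⟩

theorem IsCFTType.fixedPoints_wt_neg (hA : A.IsCFTType) (hg : A.IsAutomorphism g) (n : ℤ)
    (hn : n < 0) : (A.fixedPoints g hg).wt n = ⊥ := by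
  rw [eq_bot_iff]
  intro x hx
  have hx' : (x : V) ∈ A.wt n := hx
  rw [hA.wt_neg n hn, Submodule.mem_bot] at hx'
  exact (Submodule.mem_bot ℂ).2 (Subtype.ext hx')

theorem IsCFTType.exists_eq_smul_fixedPoints_vac (hA : A.IsCFTType) (hg : A.IsAutomorphism g)
    (c : sector g 0) (hc : c ∈ (A.fixedPoints g hg).wt 0) :
    ∃ a : ℂ, c = a • (A.fixedPoints g hg).vac := by
  obtain ⟨a, ha⟩ := hA.exists_eq_smul_vac (show (c : V) ∈ A.wt 0 from hc)
  exact ⟨a, Subtype.ext ha⟩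

/-- If `c + y ∈ J_M(V^0)` with `c` of weight zero and `y` of weight `n + 1`, then `y_j = 0` on `V^0`
for all `0 ≤ j ≤ n`. -/
theorem AdmissibleTwistedModule.mode_eq_zero_of_add_mem_radical
    (N : A.AdmissibleTwistedModule g M) (hA : A.IsCFTType) (hg : A.IsAutomorphism g)
    (hfin : IsOfFinOrder g) {n : ℕ} {c y : sector g 0} (hc : c ∈ (A.fixedPoints g hg).wt 0)
    (hy : y ∈ (A.fixedPoints g hg).wt (n + 1 : ℕ)) (h : c + y ∈ (N.restrict hg hfin).radical)
    {j : ℕ} (hj : j ≤ n) (u : sector g 0) : (A.fixedPoints g hg).mode y j u = 0 := by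
  have := N.nontrivial
  obtain ⟨a, rfl⟩ := hA.exists_eq_smul_fixedPoints_vac hg c hc
  rw [WeakModule.radical, LinearMap.mem_ker, map_add, map_smul, WeakModule.zeroMode_apply _ hy,
    WeakModule.zeroMode_apply _ (A.fixedPoints g hg).vac_mem] at h
  -- `o(𝟏)` is the identity, so `o(a𝟏 + y) = 0` forces `y_n = -a`.
  have hscalar (w : M) : N.mode y n w = (-a) • w := by
    have h1 := LinearMap.congr_fun h w
    rw [LinearMap.add_apply, LinearMap.smul_apply, WeakModule.mode_vac, if_pos (by norm_num),
      show ((n + 1 : ℕ) : ℤ) - 1 = n by push_cast; ring] at h1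
    rw [neg_smul]
    exact eq_neg_of_add_eq_zero_right h1
  exact Subtype.ext (N.mode_eq_zero_of_zeroMode_scalar hA.isSimple hfin
    (mem_sector_zero.2 hg.map_conf) hy y.2 hscalar hj u)

end

end VertexOperatorAlgebra

/-- `J_M(V^0) = (L(0) + L(-1)) V^0 + J_M(V^0)_{(0,1)}`, and the weight-one component of every
element of `J_M(V^0)_{(0,1)}` lies in `J_{V^0}(V^0)`. -/
theorem theorem5p2 {V M : Type*} [AddCommGroup V] [Module ℂ V] [AddCommGroup M] [Module ℂ M]
    (A : VertexOperatorAlgebra V) (hA : A.IsCFTType)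
    (g : V ≃ₗ[ℂ] V) (hg : A.IsAutomorphism g) (hfin : IsOfFinOrder g)
    (N : A.AdmissibleTwistedModule g M) :
    (N.restrict hg hfin).radical =
        LinearMap.range ((A.fixedPoints g hg).L 0 + (A.fixedPoints g hg).L (-1)) ⊔
          (N.restrict hg hfin).radicalZeroOne ∧
      ∀ a₀ ∈ (A.fixedPoints g hg).wt 0, ∀ a₁ ∈ (A.fixedPoints g hg).wt 1,
        a₀ + a₁ ∈ (N.restrict hg hfin).radicalZeroOne →
          a₁ ∈ (A.fixedPoints g hg).adjoint.radical := by
  have hneg := hA.fixedPoints_wt_neg hg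
  have hle := (N.restrict hg hfin).rangeL_le_radical
  refine ⟨le_antisymm (fun v hv => ?_) (sup_le hle inf_le_right), fun a₀ h₀ a₁ h₁ h => ?_⟩
  · obtain ⟨n, c, y, hc, hy, hvc⟩ := (A.fixedPoints g hg).exists_sub_mem_rangeL hneg v
    have hcy : c + y ∈ (N.restrict hg hfin).radical := by
      simpa using sub_mem hv (hle hvc)
    obtain ⟨x, hx, hyx⟩ := (A.fixedPoints g hg).exists_mem_wt_one_sub_mem hneg
      (hA.exists_eq_smul_fixedPoints_vac hg) hy fun j hj =>
        N.mode_eq_zero_of_add_mem_radical hA hg hfin hc hy hcy hj _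
    have hvx : v - (c + x) ∈ (A.fixedPoints g hg).rangeL := by
      convert add_mem hvc hyx using 1
      abel
    refine Submodule.mem_sup.2 ⟨v - (c + x), hvx, c + x, ⟨?_, ?_⟩, sub_add_cancel _ _⟩
    · exact Submodule.mem_sup.2 ⟨c, hc, x, hx, rfl⟩
    · simpa using sub_mem hv (hle hvx)
  · rw [VertexOperatorAlgebra.WeakModule.radical, LinearMap.mem_ker,
      VertexOperatorAlgebra.WeakModule.zeroMode_apply _ h₁]
    ext u : 1
    -- In weight one the zero mode is the mode `0`, so this is the case `n = j = 0`.
    exact N.mode_eq_zero_of_add_mem_radical hA hg hfin (n := 0) h₀ (by simpa using h₁) h.2 le_rfl u
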